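/- Let $K$ be a field of characteristic zero and let $n\ge 3$ be an integer. Let $K_n$ be the complete graph on $n$ vertices with edge set $E(K_n)$, and assign a variable $x_e$ to each edge $e$. Let $$F_{K_n}=\sum_{T}\prod_{e\in E(T)}x_e\in K[x_e : e\in E(K_n)]$$ be its Kirchhoff polynomial, where $T$ runs over all spanning trees of $K_n$. Let $$H_{K_n}=\left(\frac{\partial}{\partial x_i}\frac{\partial}{\partial x_j}F_{K_n}\right)_{i,j\in E(K_n)}$$ be the Hessian matrix of $K_n$, and let $\tilde H_{K_n}$ be the matrix obtained from $H_{K_n}$ by setting $x_e=1$ for all $e\in E(K_n)$. Then $$\det\tilde H_{K_n}=(-1)^{\binom n2-1}\,2^{\binom n2-n+1}\,n^{\,n+\binom n2(n-4)}\,(n-2).$$ Hence the Hessian $\det H_{K_n}$ is not the zero polynomial. -/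

import Mathlib

noncomputable section

/-- The finite set of spanning trees of a finite simple graph `G`: the subgraphs of `G` on the
whole vertex set `V` that are trees. -/
def spanningTrees {V : Type*} [Fintype V] (G : SimpleGraph V) : Finset (SimpleGraph V) :=
  (Set.toFinite {T : SimpleGraph V | T ≤ G ∧ T.IsTree}).toFinset

open Classical in
/-- The Kirchhoff polynomial `∑_T ∏_{e ∈ E(T)} x_e` of `G`, where `T` runs over the spanning trees
of `G`, in the polynomial ring over `K` with one variable `x_e` for each edge `e` of `G`. -/
def kirchhoffPolynomial (K : Type*) [Field K] {V : Type*} [Fintype V] (G : SimpleGraph V) :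
    MvPolynomial G.edgeSet K :=
  ∑ T ∈ spanningTrees G, ∏ e ∈ Finset.univ.filter (fun e : G.edgeSet => e.val ∈ T.edgeSet),
    MvPolynomial.X e

/-- The Hessian matrix of `G`: the matrix of second partial derivatives of the
Kirchhoff polynomial. -/
def hessianMatrix (K : Type*) [Field K] {V : Type*} [Fintype V] (G : SimpleGraph V) :
    Matrix G.edgeSet G.edgeSet (MvPolynomial G.edgeSet K) :=
  Matrix.of fun i j =>
    MvPolynomial.pderiv i (MvPolynomial.pderiv j (kirchhoffPolynomial K G))

/-- The value of the Hessian matrix of `G` at the point where all variables equal `1`. -/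
def hessianMatrixAtOne (K : Type*) [Field K] {V : Type*} [Fintype V] (G : SimpleGraph V) :
    Matrix G.edgeSet G.edgeSet K :=
  (hessianMatrix K G).map (MvPolynomial.eval fun _ => (1 : K))

end

/-!
Evaluated at `(1, …, 1)`, the Hessian counts the spanning trees through two given edges. If a
forest `F` on `n` vertices has components of orders `m₁, …, m_c`, then exactly
`n ^ (c - 2) * ∏ mᵢ` trees contain `F` (Moon's generalisation of Cayley's formula). This goes by
induction on `c`: count pairs of a tree containing `F` and an oriented edge of it joining two
components of `F`. Each tree has `2 * (c - 1)` such edges, while joining components of orders `p`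
and `q` multiplies the product of the orders by `1 / p + 1 / q`, which sums to `2 * n * (c - 1)`
over the ordered pairs of vertices in distinct components.

So edges `e ≠ f` lie in `n ^ (n - 4) * (4 - |e ∩ f|)` common trees, and the Hessian at `(1, …, 1)`
is `n ^ (n - 4) * (4 J - 2 I - Bᵀ B)`, where `B` is the incidence matrix and `J` the all-ones
matrix. Since `Bᵀ J B = 4 J`, the bracket is `Bᵀ (J - I) B - 2 I`, and Sylvester's determinant
identity replaces it by `(J - I) B Bᵀ - 2 I` on the vertices. There `B Bᵀ = (n - 2) I + J` leaves
a rank-one perturbation of `-n I`. All of this happens over `ℤ`, so the formula holds in every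
characteristic.
-/

section Forests

open Finset SimpleGraph

variable {V : Type*} {F T : SimpleGraph V} {a b : V}

lemma reachable_sup_edge_iff {u v : V} :
    (F ⊔ edge a b).Reachable u v ↔ F.Reachable u v ∨
      F.Reachable u a ∧ F.Reachable b v ∨ F.Reachable u b ∧ F.Reachable a v := by
  have le : F ≤ F ⊔ edge a b := le_sup_left
  have new : (F ⊔ edge a b).Reachable a b := by
    by_cases hab : a = b
    · rw [hab]
    · exact Adj.reachable (by simp [edge_adj, hab])
  constructor
  · rintro ⟨p⟩
    induction p with
    | nil => exact .inl .rfl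
    | cons hadj _ ih =>
      rcases hadj with hadj | hadj
      · have := hadj.reachable
        rcases ih with h | ⟨h, h'⟩ | ⟨h, h'⟩
        · exact .inl (this.trans h)
        · exact .inr (.inl ⟨this.trans h, h'⟩)
        · exact .inr (.inr ⟨this.trans h, h'⟩)
      · rcases (edge_adj ..).1 hadj |>.1 with ⟨rfl, rfl⟩ | ⟨rfl, rfl⟩
        · rcases ih with h | ⟨-, h⟩ | ⟨-, h⟩
          exacts [.inr (.inl ⟨.rfl, h⟩), .inr (.inl ⟨.rfl, h⟩), .inl h]
        · rcases ih with h | ⟨-, h⟩ | ⟨-, h⟩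
          exacts [.inr (.inr ⟨.rfl, h⟩), .inl h, .inr (.inr ⟨.rfl, h⟩)]
  · rintro (h | ⟨h, h'⟩ | ⟨h, h'⟩)
    · exact h.mono le
    · exact (h.mono le).trans (new.trans (h'.mono le))
    · exact (h.mono le).trans (new.symm.trans (h'.mono le))

lemma reachable_edge_iff {u v : V} :
    (edge a b).Reachable u v ↔ u = v ∨ u = a ∧ b = v ∨ u = b ∧ a = v := by
  simpa using reachable_sup_edge_iff (F := ⊥) (a := a) (b := b) (u := u) (v := v)

/-- The number of vertices in the connected component of `v`, the statistic that governs how the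
number of trees containing a forest changes when an edge is added to the forest. -/
noncomputable def componentOrder (F : SimpleGraph V) (v : V) : ℕ :=
  (F.connectedComponentMk v).supp.ncard

lemma componentOrder_eq_ncard_reachable (F : SimpleGraph V) (v : V) :
    componentOrder F v = {w | F.Reachable w v}.ncard := by
  simp only [componentOrder, ConnectedComponent.supp, ConnectedComponent.eq]

lemma componentOrder_pos [Finite V] (F : SimpleGraph V) (v : V) : 0 < componentOrder F v :=
  (Set.ncard_pos).2 (ConnectedComponent.nonempty_supp _)

lemma componentOrder_bot (v : V) : componentOrder ⊥ v = 1 := by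
  simp [componentOrder_eq_ncard_reachable]

lemma componentOrder_edge [DecidableEq V] (hab : a ≠ b) (v : V) :
    componentOrder (edge a b) v = if v ∈ s(a, b) then 2 else 1 := by
  simp only [componentOrder_eq_ncard_reachable, reachable_edge_iff]
  split_ifs with hv
  · rw [← Set.ncard_pair hab]
    congr 1
    ext w
    simp only [Sym2.mem_iff, Set.mem_ofPred_eq, Set.mem_insert_iff, Set.mem_singleton_iff] at hv ⊢
    grind
  · rw [← Set.ncard_singleton v]
    congr 1
    ext w
    simp only [Sym2.mem_iff, Set.mem_ofPred_eq, Set.mem_singleton_iff] at hv ⊢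
    grind

lemma componentOrder_sup_edge_left [Finite V] (hab : ¬ F.Reachable a b) :
    componentOrder (F ⊔ edge a b) a = componentOrder F a + componentOrder F b := by
  simp only [componentOrder_eq_ncard_reachable]
  rw [← Set.ncard_union_eq (Set.disjoint_left.2 fun w ha hb => hab (ha.symm.trans hb))]
  congr 1
  ext w
  simp [reachable_sup_edge_iff, mt Reachable.symm hab]

lemma componentOrder_sup_edge_of_not_reachable {v : V} (ha : ¬ F.Reachable a v)
    (hb : ¬ F.Reachable b v) : componentOrder (F ⊔ edge a b) v = componentOrder F v := by
  simp [componentOrder_eq_ncard_reachable, reachable_sup_edge_iff, ha, hb]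

lemma bijective_connectedComponentMk_bot :
    Function.Bijective (⊥ : SimpleGraph V).connectedComponentMk :=
  ⟨fun _ _ h => reachable_bot.1 (ConnectedComponent.exact h), Quot.mk_surjective⟩

lemma bijective_map_sup_edge (hab : ¬ F.Reachable a b) :
    Function.Bijective fun C : {C : F.ConnectedComponent // C ≠ F.connectedComponentMk b} =>
      C.1.map (Hom.ofLE (le_sup_left : F ≤ F ⊔ edge a b)) := by
  constructor
  · rintro ⟨C, hC⟩ ⟨D, hD⟩ h
    induction C, D using ConnectedComponent.ind₂ with | _ u v
    simp only [ne_eq, ConnectedComponent.eq] at hC hD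
    have huv : (F ⊔ edge a b).Reachable u v := ConnectedComponent.exact h
    have : F.Reachable u v := by
      simpa [reachable_sup_edge_iff, hC, mt Reachable.symm hD] using huv
    simpa using this
  · refine ConnectedComponent.ind fun v => ?_
    by_cases hv : F.Reachable v b
    · exact ⟨⟨F.connectedComponentMk a, by simpa using hab⟩,
        ConnectedComponent.sound (reachable_sup_edge_iff.2 (.inr (.inl ⟨.rfl, hv.symm⟩)))⟩
    · exact ⟨⟨F.connectedComponentMk v, by simpa using hv⟩, rfl⟩

lemma card_connectedComponent_sup_edge [Finite V] (hab : ¬ F.Reachable a b) :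
    Nat.card (F ⊔ edge a b).ConnectedComponent + 1 = Nat.card F.ConnectedComponent := by
  rw [← Nat.card_congr (Equiv.ofBijective _ (bijective_map_sup_edge hab)),
    ← Set.ncard_add_ncard_compl {F.connectedComponentMk b}, Set.ncard_singleton, add_comm]
  rfl

lemma prod_ncard_supp_sup_edge [Finite V] [Fintype F.ConnectedComponent]
    [Fintype (F ⊔ edge a b).ConnectedComponent] (hab : ¬ F.Reachable a b) :
    ∏ C : (F ⊔ edge a b).ConnectedComponent, (C.supp.ncard : ℚ) =
      ((componentOrder F a : ℚ)⁻¹ + (componentOrder F b : ℚ)⁻¹) *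
        ∏ C : F.ConnectedComponent, (C.supp.ncard : ℚ) := by
  classical
  set ca := F.connectedComponentMk a
  set cb := F.connectedComponentMk b
  have hca : ca ∈ univ.erase cb := by simpa [ca, cb] using hab
  have unmerged : ∀ C ∈ (univ.erase cb).erase ca,
      ((C.map (Hom.ofLE (le_sup_left : F ≤ F ⊔ edge a b))).supp.ncard : ℚ) = C.supp.ncard := by
    intro C hC
    induction C using ConnectedComponent.ind with | _ v
    simp only [mem_erase, ne_eq, ConnectedComponent.eq, mem_univ, and_true, ca, cb] at hC
    exact congrArg _ (componentOrder_sup_edge_of_not_reachable (mt Reachable.symm hC.1)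
      (mt Reachable.symm hC.2))
  have merged : ((ca.map (Hom.ofLE (le_sup_left : F ≤ F ⊔ edge a b))).supp.ncard : ℚ) =
      componentOrder F a + componentOrder F b := by
    exact_mod_cast componentOrder_sup_edge_left hab
  have ha := componentOrder_pos F a
  have hb := componentOrder_pos F b
  rw [← (bijective_map_sup_edge hab).prod_comp (fun C => (C.supp.ncard : ℚ)),
    ← prod_subtype (univ.erase cb) (by simp [cb])
      (fun C => ((C.map (Hom.ofLE (le_sup_left : F ≤ F ⊔ edge a b))).supp.ncard : ℚ)),
    ← mul_prod_erase _ _ hca, prod_congr rfl unmerged, merged,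
    ← mul_prod_erase univ _ (mem_univ cb), ← mul_prod_erase _ _ hca]
  change _ = _ * ((componentOrder F b : ℚ) * ((componentOrder F a : ℚ) * _))
  field_simp
  ring

lemma ncard_edgeSet_add_card_connectedComponent [Finite V] (hF : F.IsAcyclic) :
    F.edgeSet.ncard + Nat.card F.ConnectedComponent = Nat.card V := by
  induction h : Nat.card F.ConnectedComponent using Nat.strong_induction_on generalizing F with
  | _ k ih =>
    by_cases hconn : F.Preconnected
    · cases isEmpty_or_nonempty V
      · simp [← h, Subsingleton.elim F ⊥]
      · have : Subsingleton F.ConnectedComponent := hconn.subsingleton_connectedComponent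
        have : Nonempty F.ConnectedComponent := inferInstance
        rw [← h, Nat.card_unique]
        exact (isTree_iff_connected_and_card.1 ⟨⟨hconn⟩, hF⟩).2
    · simp only [Preconnected, not_forall] at hconn
      obtain ⟨a, b, hab⟩ := hconn
      have hne : a ≠ b := fun h => hab (h ▸ .rfl)
      have hcomp := card_connectedComponent_sup_edge hab
      have hedge : (F ⊔ edge a b).edgeSet.ncard = F.edgeSet.ncard + 1 := by
        rw [edgeSet_sup, edgeSet_edge_of_ne hne, Set.union_singleton,
          Set.ncard_insert_of_notMem (show s(a, b) ∉ F.edgeSet from mt Adj.reachable hab)]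
      have := ih _ (by omega) (hF.sup_edge_of_not_reachable hab) rfl
      omega

lemma adj_of_reachable_of_le (hT : T.IsAcyclic) (hle : F ≤ T) {u v : V} (hadj : T.Adj u v)
    (hr : F.Reachable u v) : F.Adj u v := by
  by_contra hF
  refine isBridge_iff.1 (isAcyclic_iff_forall_adj_isBridge.1 hT hadj) (hr.mono fun x y hxy => ?_)
  have : s(x, y) ≠ s(u, v) := fun h => hF (by rwa [← mem_edgeSet, ← h])
  simp [hle hxy, this]

lemma sup_edge_le_iff (hab : a ≠ b) : F ⊔ edge a b ≤ T ↔ F ≤ T ∧ T.Adj a b := by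
  simp [hab]

variable [Fintype V]

open Classical in
lemma card_tree_adj_not_reachable (hT : T.IsTree) (hle : F ≤ T) :
    #{p : V × V | T.Adj p.1 p.2 ∧ ¬ F.Reachable p.1 p.2} + 2 =
      2 * Nat.card F.ConnectedComponent := by
  have split : #{p : V × V | T.Adj p.1 p.2} =
      #{p : V × V | F.Adj p.1 p.2} + #{p : V × V | T.Adj p.1 p.2 ∧ ¬ F.Reachable p.1 p.2} := by
    rw [← card_filter_add_card_filter_not (s := {p : V × V | T.Adj p.1 p.2})
      (fun p => F.Reachable p.1 p.2), filter_filter, filter_filter]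
    congr! 3 with p
    exact ⟨fun ⟨hadj, hr⟩ => adj_of_reachable_of_le hT.isAcyclic hle hadj hr,
      fun hadj => ⟨hle hadj, hadj.reachable⟩⟩
  have hFcard := ncard_edgeSet_add_card_connectedComponent (hT.isAcyclic.anti hle)
  have hTcard := hT.card_edgeFinset
  rw [← coe_edgeFinset, Set.ncard_coe_finset, Nat.card_eq_fintype_card (α := V)] at hFcard
  have hF2 : 2 * #F.edgeFinset = #{p : V × V | F.Adj p.1 p.2} := F.two_mul_card_edgeFinset
  have hT2 : 2 * #T.edgeFinset = #{p : V × V | T.Adj p.1 p.2} := T.two_mul_card_edgeFinset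
  omega

lemma sum_inv_componentOrder (F : SimpleGraph V) :
    ∑ u, (componentOrder F u : ℚ)⁻¹ = Nat.card F.ConnectedComponent := by
  classical
  rw [← sum_fiberwise univ F.connectedComponentMk, Nat.card_eq_fintype_card,
    Fintype.card_eq_sum_ones, Nat.cast_sum]
  refine sum_congr rfl fun C _ => ?_
  have hC : 0 < C.supp.ncard := (Set.ncard_pos).2 C.nonempty_supp
  have hcard : #{u | F.connectedComponentMk u = C} = C.supp.ncard := by
    rw [Set.ncard_eq_toFinset_card']
    congr 1
    ext
    simp
  rw [sum_congr rfl (g := fun _ => (C.supp.ncard : ℚ)⁻¹) (by simp +contextual [componentOrder]),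
    sum_const, hcard, nsmul_eq_mul]
  exact mul_inv_cancel₀ (Nat.cast_ne_zero.2 hC.ne')

open Classical in
lemma sum_inv_componentOrder_add_inv_of_not_reachable (F : SimpleGraph V) :
    ∑ p : V × V with ¬ F.Reachable p.1 p.2,
      ((componentOrder F p.1 : ℚ)⁻¹ + (componentOrder F p.2 : ℚ)⁻¹) =
      2 * (Fintype.card V * (Nat.card F.ConnectedComponent - 1)) := by
  have row (u : V) : ∑ v, (if ¬ F.Reachable u v then (componentOrder F u : ℚ)⁻¹ else 0) =
      Fintype.card V * (componentOrder F u : ℚ)⁻¹ - 1 := by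
    have hcard : componentOrder F u + #{v | ¬ F.Reachable u v} = Fintype.card V := by
      rw [← card_univ, ← card_filter_add_card_filter_not (s := univ) (F.Reachable u),
        componentOrder_eq_ncard_reachable]
      simp [Set.ncard_eq_toFinset_card', reachable_comm]
    have := componentOrder_pos F u
    rw [← sum_filter, sum_const, nsmul_eq_mul, ← hcard, Nat.cast_add]
    field_simp
    ring
  have total : ∑ p : V × V with ¬ F.Reachable p.1 p.2, (componentOrder F p.1 : ℚ)⁻¹ =
      Fintype.card V * (Nat.card F.ConnectedComponent - 1) := by
    rw [sum_filter, Fintype.sum_prod_type]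
    simp only [row]
    rw [sum_sub_distrib, ← mul_sum, sum_inv_componentOrder, sum_const, card_univ, nsmul_one,
      mul_sub_one]
  rw [sum_add_distrib, two_mul, total, add_right_inj, ← total]
  refine sum_nbij' Prod.swap Prod.swap ?_ ?_ ?_ ?_ ?_ <;> simp [reachable_comm]

lemma mem_spanningTrees_top : T ∈ spanningTrees (⊤ : SimpleGraph V) ↔ T.IsTree := by
  simp [spanningTrees]

open Classical in
lemma filter_le_spanningTrees_top_eq_singleton (hF : F.IsTree) :
    {T ∈ spanningTrees (⊤ : SimpleGraph V) | F ≤ T} = {F} := by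
  ext T
  simp only [mem_filter, mem_spanningTrees_top, mem_singleton]
  constructor
  · rintro ⟨hT, hle⟩
    exact le_antisymm
      (fun u v huv => adj_of_reachable_of_le hT.isAcyclic hle huv (hF.connected u v)) hle
  · rintro rfl
    exact ⟨hF, le_rfl⟩

open Classical in
lemma sum_card_spanningTrees_sup_edge (F : SimpleGraph V) :
    ∑ p : V × V with ¬ F.Reachable p.1 p.2,
        #{T ∈ spanningTrees (⊤ : SimpleGraph V) | F ⊔ edge p.1 p.2 ≤ T} =
      #{T ∈ spanningTrees (⊤ : SimpleGraph V) | F ≤ T} *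
        (2 * Nat.card F.ConnectedComponent - 2) := by
  calc
    _ = ∑ p : V × V with ¬ F.Reachable p.1 p.2,
          #{T ∈ {T ∈ spanningTrees (⊤ : SimpleGraph V) | F ≤ T} | T.Adj p.1 p.2} := by
      refine sum_congr rfl fun p hp => ?_
      have hne : p.1 ≠ p.2 := fun h => (mem_filter.1 hp).2 (h ▸ .rfl)
      simp only [filter_filter, sup_edge_le_iff hne]
    _ = ∑ T ∈ spanningTrees (⊤ : SimpleGraph V) with F ≤ T,
          #{p ∈ {p : V × V | ¬ F.Reachable p.1 p.2} | T.Adj p.1 p.2} :=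
      sum_card_bipartiteAbove_eq_sum_card_bipartiteBelow _
    _ = _ := by
      refine sum_const_nat fun T hT => ?_
      rw [mem_filter, mem_spanningTrees_top] at hT
      have := card_tree_adj_not_reachable hT.1 hT.2
      rw [filter_comm, filter_filter]
      omega

open Classical in
/-- The factor `|V| ^ 2` stays on the left because the usual exponent, the number of components
minus two, is negative when `F` is already a tree. -/
theorem card_spanningTrees_top_filter_le [Nonempty V] [Fintype F.ConnectedComponent]
    (hF : F.IsAcyclic) :
    (Fintype.card V : ℚ) ^ 2 * #{T ∈ spanningTrees (⊤ : SimpleGraph V) | F ≤ T} =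
      Fintype.card V ^ Nat.card F.ConnectedComponent *
        ∏ C : F.ConnectedComponent, (C.supp.ncard : ℚ) := by
  obtain ⟨c, hc⟩ : ∃ c, Nat.card F.ConnectedComponent = c + 1 :=
    Nat.exists_eq_succ_of_ne_zero Nat.card_pos.ne'
  induction c generalizing F with
  | zero =>
    obtain ⟨_, ⟨C⟩⟩ := Nat.card_eq_one_iff_unique.1 hc
    have hconn : F.Connected := ⟨fun u v => ConnectedComponent.exact (Subsingleton.elim _ _)⟩
    have hsupp : C.supp = Set.univ := Set.eq_univ_of_forall fun v => Subsingleton.elim _ _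
    rw [filter_le_spanningTrees_top_eq_singleton ⟨hconn, hF⟩, hc,
      Fintype.prod_subsingleton _ C, hsupp, Set.ncard_univ, Nat.card_eq_fintype_card]
    simp [sq]
  | succ c ih =>
    have step (p) (hp : p ∈ ({p : V × V | ¬ F.Reachable p.1 p.2} : Finset _)) :
        (Fintype.card V : ℚ) ^ 2 *
            #{T ∈ spanningTrees (⊤ : SimpleGraph V) | F ⊔ edge p.1 p.2 ≤ T} =
          Fintype.card V ^ (c + 1) *
            (((componentOrder F p.1 : ℚ)⁻¹ + (componentOrder F p.2 : ℚ)⁻¹) *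
              ∏ C : F.ConnectedComponent, (C.supp.ncard : ℚ)) := by
      have hp := (mem_filter.1 hp).2
      have hcard : Nat.card (F ⊔ edge p.1 p.2).ConnectedComponent = c + 1 := by
        have := card_connectedComponent_sup_edge hp
        omega
      rw [ih (hF.sup_edge_of_not_reachable hp) hcard, hcard, prod_ncard_supp_sup_edge hp]
    have sum_step := sum_congr rfl step
    have double_count := congrArg (Nat.cast (R := ℚ)) (sum_card_spanningTrees_sup_edge F)
    rw [hc, show 2 * (c + 1 + 1) - 2 = 2 * (c + 1) by omega] at double_count
    push_cast at double_count
    rw [← mul_sum, double_count, ← mul_sum, ← sum_mul,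
      sum_inv_componentOrder_add_inv_of_not_reachable, hc] at sum_step
    push_cast at sum_step
    rw [hc]
    apply mul_right_cancel₀ (show (2 * (c + 1) : ℚ) ≠ 0 by positivity)
    linear_combination sum_step

open Classical in
lemma card_spanningTrees_top_filter_adj_adj {c d : V} (hab : a ≠ b)
    (hcd : ¬ (edge a b).Reachable c d) :
    (Fintype.card V : ℚ) ^ 2 *
        #{T ∈ spanningTrees (⊤ : SimpleGraph V) | T.Adj a b ∧ T.Adj c d} =
      Fintype.card V ^ (Fintype.card V - 2) *
        (2 * ((componentOrder (edge a b) c : ℚ)⁻¹ + (componentOrder (edge a b) d : ℚ)⁻¹)) := by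
  have : Nonempty V := ⟨a⟩
  have hab' : ¬ (⊥ : SimpleGraph V).Reachable a b := by simpa using hab
  rw [← bot_sup_eq (edge a b)] at hcd
  have count := card_spanningTrees_top_filter_le
    ((isAcyclic_bot.sup_edge_of_not_reachable hab').sup_edge_of_not_reachable hcd)
  have card_eq : Nat.card (⊥ ⊔ edge a b ⊔ edge c d).ConnectedComponent = Fintype.card V - 2 := by
    have h₀ := Nat.card_congr (Equiv.ofBijective _ (bijective_connectedComponentMk_bot (V := V)))
    have h₁ := card_connectedComponent_sup_edge hab'
    have h₂ := card_connectedComponent_sup_edge hcd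
    rw [Nat.card_eq_fintype_card] at h₀
    omega
  have prod_bot : ∏ C : (⊥ : SimpleGraph V).ConnectedComponent, (C.supp.ncard : ℚ) = 1 := by
    rw [← bijective_connectedComponentMk_bot.prod_comp]
    exact prod_eq_one fun v _ => by exact_mod_cast componentOrder_bot v
  have hne : c ≠ d := fun h => hcd (h ▸ .rfl)
  rw [card_eq, prod_ncard_supp_sup_edge hcd, prod_ncard_supp_sup_edge hab', prod_bot,
    componentOrder_bot, componentOrder_bot] at count
  simp only [sup_edge_le_iff hne, sup_edge_le_iff hab, bot_le, true_and] at count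
  rw [count, bot_sup_eq, Nat.cast_one]
  ring

open Classical in
theorem card_spanningTrees_top_filter_mem_edgeSet [DecidableEq V] {e f : Sym2 V}
    (he : ¬ e.IsDiag) (hf : ¬ f.IsDiag) (hef : e ≠ f) :
    (Fintype.card V : ℚ) ^ 2 *
        #{T ∈ spanningTrees (⊤ : SimpleGraph V) | e ∈ T.edgeSet ∧ f ∈ T.edgeSet} =
      Fintype.card V ^ (Fintype.card V - 2) * (4 - #{v | v ∈ e ∧ v ∈ f}) := by
  induction e with | _ a b
  induction f with | _ c d
  rw [Sym2.mk_isDiag_iff] at he hf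
  have hcd : ¬ (edge a b).Reachable c d := by
    rw [reachable_edge_iff]
    grind
  have inter : ({v | v ∈ s(a, b) ∧ v ∈ s(c, d)} : Finset V) =
      ({c, d} : Finset V).filter (· ∈ s(a, b)) := by
    ext
    simp [and_comm]
  simp only [mem_edgeSet]
  rw [card_spanningTrees_top_filter_adj_adj he hcd, inter, card_filter, sum_pair hf,
    componentOrder_edge he, componentOrder_edge he]
  split_ifs <;> norm_num

end Forests

section Hessian

open Finset MvPolynomial

lemma pderiv_prod_X {σ R : Type*} [DecidableEq σ] [CommSemiring R] (A : Finset σ) (j : σ) :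
    pderiv j (∏ e ∈ A, (X e : MvPolynomial σ R)) =
      if j ∈ A then ∏ e ∈ A.erase j, X e else 0 := by
  have deriv_eq_zero (B : Finset σ) (hB : j ∉ B) :
      pderiv j (∏ e ∈ B, (X e : MvPolynomial σ R)) = 0 := by
    nontriviality R
    refine pderiv_eq_zero_of_notMem_vars fun h => hB ?_
    simpa using vars_prod _ h
  split_ifs with h
  · rw [← mul_prod_erase A _ h, Derivation.leibniz, deriv_eq_zero _ (notMem_erase j A),
      pderiv_X_self]
    simp
  · exact deriv_eq_zero A h

open Classical in
/-- The matrix counting, for each pair of distinct edges of `G`, the spanning trees of `G` through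
both; the diagonal is zero. It is the Hessian matrix of `G` at the point `(1, …, 1)`, over `ℤ`. -/
noncomputable def treePairMatrix {V : Type*} [Fintype V] (G : SimpleGraph V) :
    Matrix G.edgeSet G.edgeSet ℤ :=
  .of fun i j =>
    if i = j then 0 else #{T ∈ spanningTrees G | i.val ∈ T.edgeSet ∧ j.val ∈ T.edgeSet}

lemma hessianMatrixAtOne_eq_map_treePairMatrix (K : Type*) [Field K] {V : Type*} [Fintype V]
    (G : SimpleGraph V) : hessianMatrixAtOne K G = (treePairMatrix G).map (Int.cast : ℤ → K) := by
  classical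
  ext i j
  have eval_deriv (T : SimpleGraph V) : eval (fun _ => (1 : K)) (pderiv i (pderiv j
      (∏ e : G.edgeSet with e.val ∈ T.edgeSet, X e))) =
      if i ≠ j ∧ i.val ∈ T.edgeSet ∧ j.val ∈ T.edgeSet then 1 else 0 := by
    rw [pderiv_prod_X]
    by_cases hj : j.val ∈ T.edgeSet
    · simp only [mem_filter, mem_univ, true_and, hj, if_true, pderiv_prod_X, mem_erase, and_true]
      split_ifs <;> simp
    · simp [hj]
  simp only [hessianMatrixAtOne, hessianMatrix, treePairMatrix, Matrix.map_apply, Matrix.of_apply,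
    kirchhoffPolynomial, map_sum, eval_deriv]
  split_ifs with h <;> simp [h]

end Hessian

section Determinant

open Finset Matrix

lemma pow_mul_det_scalar_sub_mul_comm {R m n : Type*} [CommRing R] [Fintype m] [Fintype n]
    [DecidableEq m] [DecidableEq n] (A : Matrix m n R) (B : Matrix n m R) (a : R) :
    a ^ Fintype.card n * (scalar m a - A * B).det =
      a ^ Fintype.card m * (scalar n a - B * A).det := by
  simpa [eval_charpoly] using congrArg (Polynomial.eval a) (charpoly_mul_comm' A B)

lemma det_scalar_sub_vecMulVec {R n : Type*} [CommRing R] [Fintype n] [DecidableEq n] [Nonempty n]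
    (u v : n → R) (a : R) :
    (scalar n a - vecMulVec u v).det = a ^ (Fintype.card n - 1) * (a - u ⬝ᵥ v) := by
  rw [← eval_charpoly, charpoly_vecMulVec, Polynomial.eval_sub, Polynomial.eval_smul,
    Polynomial.eval_pow, Polynomial.eval_pow, Polynomial.eval_X, smul_eq_mul, mul_sub,
    pow_sub_one_mul Fintype.card_ne_zero, mul_comm (u ⬝ᵥ v)]

/-- The vertex-edge incidence matrix of `G`. Unlike Mathlib's `SimpleGraph.incMatrix`, whose
columns are indexed by all unordered pairs, it only has columns for the edges of `G`. -/
def edgeIncMatrix (R : Type*) [Zero R] [One R] {V : Type*} [DecidableEq V]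
    (G : SimpleGraph V) [DecidableRel G.Adj] : Matrix V G.edgeSet R :=
  (G.incMatrix R).submatrix id Subtype.val

variable {R : Type*} [CommRing R] {V : Type*} [DecidableEq V] (G : SimpleGraph V)
  [DecidableRel G.Adj]

lemma edgeIncMatrix_apply (v : V) (e : G.edgeSet) :
    edgeIncMatrix R G v e = if v ∈ e.val then 1 else 0 := by
  simp [edgeIncMatrix, SimpleGraph.incMatrix_apply', SimpleGraph.incidenceSet]

variable [Fintype V]

lemma transpose_mul_edgeIncMatrix_apply (e f : G.edgeSet) :
    ((edgeIncMatrix R G)ᵀ * edgeIncMatrix R G) e f = #{v | v ∈ e.val ∧ v ∈ f.val} := by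
  simp [edgeIncMatrix_apply, mul_apply, ← ite_and, sum_boole, and_comm]

lemma transpose_mul_edgeIncMatrix_apply_self (e : G.edgeSet) :
    ((edgeIncMatrix R G)ᵀ * edgeIncMatrix R G) e e = 2 :=
  (G.incMatrix_transpose_mul_diag (R := R)).trans (if_pos e.2)

lemma edgeIncMatrix_mul_transpose :
    edgeIncMatrix R G * (edgeIncMatrix R G)ᵀ = G.incMatrix R * (G.incMatrix R)ᵀ := by
  ext v w
  refine Fintype.sum_of_injective _ Subtype.val_injective _ _ (fun e he => ?_) fun _ => rfl
  exact mul_eq_zero_of_left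
    (G.incMatrix_of_notMem_incidenceSet fun h => he ⟨⟨e, h.1⟩, rfl⟩) _

lemma edgeIncMatrix_top_mul_transpose :
    edgeIncMatrix R (⊤ : SimpleGraph V) * (edgeIncMatrix R (⊤ : SimpleGraph V))ᵀ =
      scalar V (Fintype.card V - 2 : R) + vecMulVec 1 1 := by
  rw [edgeIncMatrix_mul_transpose, SimpleGraph.incMatrix_mul_transpose]
  ext v w
  have : 1 ≤ Fintype.card V := Fintype.card_pos_iff.2 ⟨v⟩
  by_cases hvw : v = w
  · simp only [hvw, of_apply, if_true, SimpleGraph.complete_graph_degree, Nat.cast_sub this,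
      Matrix.add_apply, scalar_apply, diagonal_apply_eq, vecMulVec_apply, Pi.one_apply]
    push_cast
    ring
  · simp [hvw]

lemma transpose_mul_vecMulVec_one_mul_edgeIncMatrix :
    (edgeIncMatrix R G)ᵀ * ((vecMulVec 1 1 : Matrix V V R) * edgeIncMatrix R G) =
      of fun _ _ => (4 : R) := by
  have col_sum (e : G.edgeSet) : ∑ v, edgeIncMatrix R G v e = 2 :=
    G.sum_incMatrix_apply_of_mem_edgeSet e.2
  ext e f
  simp only [mul_apply, vecMulVec_apply, transpose_apply, of_apply, Pi.one_apply, mul_one, one_mul,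
    col_sum, ← sum_mul]
  norm_num

lemma det_four_sub_two_sub_transpose_mul_edgeIncMatrix [Nonempty V] :
    (2 : R) ^ Fintype.card V *
        ((of fun _ _ => 4) - scalar _ 2 - (edgeIncMatrix R (⊤ : SimpleGraph V))ᵀ *
          edgeIncMatrix R (⊤ : SimpleGraph V)).det =
      -(-1) ^ Fintype.card (⊤ : SimpleGraph V).edgeSet *
        2 ^ (Fintype.card (⊤ : SimpleGraph V).edgeSet + 1) *
        Fintype.card V ^ Fintype.card V * (Fintype.card V - 2) := by
  set B := edgeIncMatrix R (⊤ : SimpleGraph V) with hB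
  set J : Matrix V V R := vecMulVec 1 1 with hJ
  set n : R := (Fintype.card V : R) with hn
  have factor : (of fun _ _ => 4) - scalar _ 2 - Bᵀ * B =
      -(scalar _ 2 - Bᵀ * ((J - 1) * B)) := by
    rw [← transpose_mul_vecMulVec_one_mul_edgeIncMatrix, Matrix.sub_mul, Matrix.mul_sub,
      Matrix.one_mul]
    abel
  have sq_ones : J * J = n • J := by
    rw [hJ, vecMulVec_mul_vecMulVec, one_dotProduct_one, vecMulVec_smul]
  have vertex_side : scalar V 2 - (J - 1) * B * Bᵀ =
      scalar V n - vecMulVec 1 ((2 * n - 3) • 1) := by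
    simp only [scalar_apply, ← smul_one_eq_diagonal, vecMulVec_smul, ← hJ, Matrix.mul_assoc, hB,
      edgeIncMatrix_top_mul_transpose, Matrix.sub_mul, Matrix.mul_add, Matrix.mul_smul, sq_ones,
      Matrix.mul_one, Matrix.one_mul]
    module
  have ones : (1 : V → R) ⬝ᵥ ((2 * n - 3) • 1) = (2 * n - 3) * n := by
    simp [dotProduct_smul, hn]
  rw [factor, det_neg, mul_left_comm, pow_mul_det_scalar_sub_mul_comm, vertex_side,
    det_scalar_sub_vecMulVec, ones, ← pow_sub_one_mul (Fintype.card_ne_zero (α := V)) n]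
  ring

end Determinant

section CompleteGraph

open Finset Matrix

variable {V : Type*} [Fintype V] [DecidableEq V]

lemma card_edgeSet_top :
    Fintype.card (⊤ : SimpleGraph V).edgeSet = (Fintype.card V).choose 2 := by
  rw [← SimpleGraph.edgeFinset_card, SimpleGraph.card_edgeFinset_top_eq_card_choose_two]

lemma card_pow_four_smul_treePairMatrix_top :
    (Fintype.card V : ℤ) ^ 4 • treePairMatrix (⊤ : SimpleGraph V) =
      (Fintype.card V : ℤ) ^ Fintype.card V • ((of fun _ _ => 4) - scalar _ 2 -
        (edgeIncMatrix ℤ (⊤ : SimpleGraph V))ᵀ * edgeIncMatrix ℤ (⊤ : SimpleGraph V)) := by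
  ext e f
  rw [Matrix.smul_apply, Matrix.smul_apply, Matrix.sub_apply, Matrix.sub_apply, treePairMatrix,
    of_apply, of_apply, scalar_apply, diagonal_apply]
  split_ifs with hef
  · rw [hef, transpose_mul_edgeIncMatrix_apply_self]
    simp
  · have count := card_spanningTrees_top_filter_mem_edgeSet
      ((⊤ : SimpleGraph V).not_isDiag_of_mem_edgeSet e.2)
      ((⊤ : SimpleGraph V).not_isDiag_of_mem_edgeSet f.2) (mt Subtype.ext hef)
    rw [transpose_mul_edgeIncMatrix_apply, smul_eq_mul, smul_eq_mul, sub_zero]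
    have two_le : 2 ≤ Fintype.card V := by
      rw [← Nat.choose_ne_zero_iff, ← card_edgeSet_top]
      exact (Fintype.card_pos_iff.2 ⟨e⟩).ne'
    rw [← pow_sub_mul_pow _ two_le]
    qify
    simp only [show (4 : ℕ) = 2 + 2 from rfl, pow_add]
    linear_combination (Fintype.card V : ℚ) ^ 2 * count

lemma det_treePairMatrix_top [Nonempty V] {b c : ℕ}
    (hb : b + Fintype.card V = (Fintype.card V).choose 2 + 1)
    (hc : c + 4 * (Fintype.card V).choose 2 =
      Fintype.card V + Fintype.card V * (Fintype.card V).choose 2) :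
    (treePairMatrix (⊤ : SimpleGraph V)).det =
      -(-1) ^ (Fintype.card V).choose 2 * 2 ^ b * Fintype.card V ^ c * (Fintype.card V - 2) := by
  have scaled := congrArg det (card_pow_four_smul_treePairMatrix_top (V := V))
  have gram := det_four_sub_two_sub_transpose_mul_edgeIncMatrix (R := ℤ) (V := V)
  rw [det_smul, det_smul, ← pow_mul, ← pow_mul, card_edgeSet_top] at scaled
  rw [card_edgeSet_top, ← hb, pow_add] at gram
  have card_ne : (Fintype.card V : ℤ) ≠ 0 := Nat.cast_ne_zero.2 Fintype.card_ne_zero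
  have pow_card := congrArg ((Fintype.card V : ℤ) ^ ·) hc
  simp only [pow_add] at pow_card
  apply mul_left_cancel₀ (mul_ne_zero (pow_ne_zero (Fintype.card V) (two_ne_zero (α := ℤ)))
    (pow_ne_zero (4 * (Fintype.card V).choose 2) card_ne))
  linear_combination (2 : ℤ) ^ Fintype.card V * scaled +
    (Fintype.card V : ℤ) ^ (Fintype.card V * (Fintype.card V).choose 2) * gram +
    (-1) ^ (Fintype.card V).choose 2 * 2 ^ b * 2 ^ Fintype.card V * (Fintype.card V - 2) * pow_card

lemma le_choose_two_add_one (n : ℕ) : n ≤ n.choose 2 + 1 := by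
  cases n with
  | zero => exact Nat.zero_le _
  | succ n => rw [Nat.choose_succ_succ', Nat.choose_one_right]; omega

lemma four_mul_choose_two_le {n : ℕ} (hn : n ≠ 0) : 4 * n.choose 2 ≤ n + n * n.choose 2 := by
  obtain h | h := lt_or_ge n 4
  · interval_cases n <;> simp_all [Nat.choose]
  · exact (Nat.mul_le_mul_right _ h).trans (Nat.le_add_left _ _)

lemma det_hessianMatrixAtOne (K : Type*) [Field K] (G : SimpleGraph V) [Fintype G.edgeSet] :
    (hessianMatrixAtOne K G).det = MvPolynomial.eval (fun _ => 1) (hessianMatrix K G).det :=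
  (RingHom.map_det _ _).symm

end CompleteGraph

theorem mainTheorem2_general (K : Type*) [Field K] (V : Type*) [Fintype V] [DecidableEq V]
    [Nonempty V] :
    (hessianMatrixAtOne K (⊤ : SimpleGraph V)).det =
        (-1 : K) ^ (((Fintype.card V).choose 2 : ℤ) - 1) *
          (2 : K) ^ (((Fintype.card V).choose 2 : ℤ) - (Fintype.card V : ℤ) + 1) *
          (Fintype.card V : K) ^ ((Fintype.card V : ℤ) +
            ((Fintype.card V).choose 2 : ℤ) * ((Fintype.card V : ℤ) - 4)) *
          ((Fintype.card V : K) - 2) ∧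
      ((2 : K) ≠ 0 → (Fintype.card V : K) ≠ 0 → (Fintype.card V : K) ≠ 2 →
        (hessianMatrix K (⊤ : SimpleGraph V)).det ≠ 0) := by
  obtain ⟨b, hb⟩ := Nat.exists_eq_add_of_le' (le_choose_two_add_one (Fintype.card V))
  obtain ⟨c, hc⟩ :=
    Nat.exists_eq_add_of_le' (four_mul_choose_two_le (Fintype.card_ne_zero (α := V)))
  have sign : (-1 : K) ^ (((Fintype.card V).choose 2 : ℤ) - 1) =
      -(-1) ^ (Fintype.card V).choose 2 := by
    rw [zpow_sub₀ (by simp), zpow_natCast, zpow_one, div_neg, div_one]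
  have exponent_two : ((Fintype.card V).choose 2 : ℤ) - (Fintype.card V : ℤ) + 1 = b := by
    push_cast [← Nat.cast_inj (R := ℤ)] at hb
    linarith
  have exponent_card : (Fintype.card V : ℤ) +
      ((Fintype.card V).choose 2 : ℤ) * ((Fintype.card V : ℤ) - 4) = c := by
    push_cast [← Nat.cast_inj (R := ℤ)] at hc
    linarith
  have det_eq : (hessianMatrixAtOne K (⊤ : SimpleGraph V)).det =
      -(-1) ^ (Fintype.card V).choose 2 * 2 ^ b * (Fintype.card V : K) ^ c *
        ((Fintype.card V : K) - 2) := by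
    rw [hessianMatrixAtOne_eq_map_treePairMatrix, ← Int.cast_det,
      det_treePairMatrix_top hb.symm hc.symm]
    push_cast
    rfl
  refine ⟨?_, fun two_ne card_ne card_ne_two det_zero => ?_⟩
  · rw [sign, exponent_two, exponent_card, zpow_natCast, zpow_natCast, det_eq]
  · rw [det_hessianMatrixAtOne, det_zero, map_zero] at det_eq
    exact (by simp [two_ne, card_ne, sub_ne_zero.2 card_ne_two] : _ ≠ (0 : K)) det_eq.symm

theorem mainTheorem2 (K : Type*) [Field K] [CharZero K] (n : ℕ) (hn : 3 ≤ n) :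
    (hessianMatrixAtOne K (⊤ : SimpleGraph (Fin n))).det =
        (-1 : K) ^ ((n.choose 2 : ℤ) - 1) * (2 : K) ^ ((n.choose 2 : ℤ) - (n : ℤ) + 1) *
          (n : K) ^ ((n : ℤ) + (n.choose 2 : ℤ) * ((n : ℤ) - 4)) * ((n : K) - 2) ∧
      (hessianMatrix K (⊤ : SimpleGraph (Fin n))).det ≠ 0 := by
  have : Nonempty (Fin n) := ⟨⟨0, by omega⟩⟩
  obtain ⟨det_eq, det_ne_zero⟩ := mainTheorem2_general K (Fin n)
  rw [Fintype.card_fin] at det_eq det_ne_zero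
  exact ⟨det_eq, det_ne_zero two_ne_zero (by norm_cast; omega) (by norm_cast; omega)⟩
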